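/- Let $\lambda>0$, $0<\phi<\pi$ and $n\in\{0,1,2,\dots\}$. The Meixner–Pollaczek polynomials are $$P_n^{(\lambda)}(x;\phi)=\frac{(2\lambda)_n}{n!}\,e^{in\phi}\;{}_2F_1\!\left(-n,\ \lambda+ix;\ 2\lambda;\ 1-e^{-2i\phi}\right),\qquad x\in\mathbb R,$$ where $(a)_n=a(a+1)\cdots(a+n-1)$ is the Pochhammer symbol and ${}_2F_1$ is the Gauss hypergeometric function. Put $$\rho(x;\phi)=\frac{e^{(2\phi-\pi)x}\,|\Gamma(\lambda+ix)|^2}{2\pi},\qquad h_n(\phi)=\int_{-\infty}^{\infty}P_n^{(\lambda)}(x;\phi)^2\rho(x;\phi)\,dx,\qquad \rho_n(x;\phi)=\frac{P_n^{(\lambda)}(x;\phi)^2\rho(x;\phi)}{h_n(\phi)}.$$ Then $P_n^{(\lambda)}(x;\phi)$ is real for every real $x$; the integral defining $h_n(\phi)$ converges and $h_n(\phi)>0$; for every real $x$ the function $\rho_n(x;\cdot)$ is differentiable at $\phi$; and the Fisher information of $P_n^{(\lambda)}$ with respect to $\phi$ converges and equals $$\int_{-\infty}^{\infty}\left[\frac{\partial\rho_n}{\partial\phi}(x;\phi)\right]^2\frac{1}{\rho_n(x;\phi)}\,dx=\frac{2\left[n^2+(2n+1)\lambda\right]}{\sin^2\phi}.$$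 (The integrand is defined except at the finitely many real zeros of $P_n^{(\lambda)}(\cdot;\phi)$.) -/

import Mathlib

noncomputable section

/-- The hypergeometric form of the Meixner–Pollaczek polynomial,
`((2lam)_n / n!) e^{inφ} ₂F₁(-n, lam + ix; 2lam; 1 - e^{-2iφ})`, as a complex number. -/
def meixnerPollaczekComplex (lam : ℝ) (n : ℕ) (φ x : ℝ) : ℂ :=
  (ascPochhammer ℂ n).eval (2 * (lam : ℂ)) / (n.factorial : ℂ)
    * Complex.exp (Complex.I * (n : ℂ) * (φ : ℂ))
    * ordinaryHypergeometric (-(n : ℂ)) ((lam : ℂ) + Complex.I * (x : ℂ)) (2 * (lam : ℂ))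
        (1 - Complex.exp (-2 * Complex.I * (φ : ℂ)))

/-- The Meixner–Pollaczek polynomial `P_n^{(lam)}(x; φ)` as a real number. (The hypergeometric
expression takes real values; this is part of the conclusion of the theorem.) -/
def meixnerPollaczek (lam : ℝ) (n : ℕ) (φ x : ℝ) : ℝ :=
  (meixnerPollaczekComplex lam n φ x).re

/-- The weight `e^{(2φ - π)x} |Γ(lam + ix)|² / (2π)`. -/
def meixnerPollaczekWeight (lam φ x : ℝ) : ℝ :=
  Real.exp ((2 * φ - Real.pi) * x)
    * ‖Complex.Gamma ((lam : ℂ) + Complex.I * (x : ℂ))‖ ^ 2 / (2 * Real.pi)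

/-- The squared norm `h_n` of `P_n^{(lam)}(·; φ)` with respect to the weight. -/
def meixnerPollaczekNormSq (lam : ℝ) (n : ℕ) (φ : ℝ) : ℝ :=
  ∫ x : ℝ, meixnerPollaczek lam n φ x ^ 2 * meixnerPollaczekWeight lam φ x

/-- The normalized density `ρ_n(x) = P_n(x)² ρ(x) / h_n`. -/
def meixnerPollaczekDensity (lam : ℝ) (n : ℕ) (φ x : ℝ) : ℝ :=
  meixnerPollaczek lam n φ x ^ 2 * meixnerPollaczekWeight lam φ x
    / meixnerPollaczekNormSq lam n φ

/-- The integrand `(∂_θ f_θ(x))² / f_θ(x)` of the Fisher information of a family of densities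
`f θ : ℝ → ℝ` with respect to the real parameter `θ`. -/
def fisherIntegrand (f : ℝ → ℝ → ℝ) (θ x : ℝ) : ℝ :=
  (deriv (fun t : ℝ => f t x) θ) ^ 2 / f θ x

/-- The Fisher information of the family of densities `f` on `ℝ` at the parameter `θ`. -/
def fisherInformation (f : ℝ → ℝ → ℝ) (θ : ℝ) : ℝ :=
  ∫ x : ℝ, fisherIntegrand f θ x

end

/-! Let L_φ denote integration of polynomials against ρ(·;φ). Since ∂ρ/∂φ = 2xρ, differentiating
L_φ(p) in φ gives L_φ(2xp).

A contiguous relation for ₂F₁ gives a three-term recurrence with real coefficients, hence reality of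
P_n. Differentiating the recurrence gives sin φ ∂P_n/∂φ = n cos φ P_n - (n+2λ-1) P_{n-1}.

Only one integral is computed: Plancherel gives L_φ(1) = (2 sin φ)^(-2λ) Γ(2λ). Its logarithmic
derivative says L_φ(P_1) = 0, and differentiating L_φ(P_n) = 0 in φ yields L_φ(P_{n+1}) = 0
(`mpFunctional_mpPoly_succ`). The recurrence then gives orthogonality and h_n = c_n L_φ(1) with c_n
free of φ, so h_n'/h_n = -2λ cot φ.

Therefore P_n sin φ ∂(log ρ_n)/∂φ = (n+1) P_{n+1} - (n+2λ-1) P_{n-1} (`hasDerivAt_density`). The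
Fisher information is the squared norm of the right side over h_n sin² φ, and orthogonality
(`map_sq_sub_sq`) evaluates it: (n+1)(n+2λ) + n(n+2λ-1) = 2[n² + (2n+1)λ]. -/

open MeasureTheory Set Filter Topology ProbabilityTheory
open scoped FourierTransform

/-! ### The Gamma integral with complex rate -/

lemma integrableOn_rpow_mul_exp_neg_mul {a c : ℝ} (ha : 0 < a) (hc : 0 < c) :
    IntegrableOn (fun t : ℝ => t ^ (a - 1) * Real.exp (-(c * t))) (Ioi 0) := by
  have := integrableOn_rpow_mul_exp_neg_mul_rpow (p := 1) (s := a - 1) (b := c) (by linarith)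
    one_pos hc
  simpa using this

lemma norm_cpow_mul_cexp_neg {s r : ℂ} {t : ℝ} (ht : 0 < t) :
    ‖(t : ℂ) ^ (s - 1) * Complex.exp (-(r * t))‖ = t ^ (s.re - 1) * Real.exp (-(r.re * t)) := by
  rw [norm_mul, Complex.norm_cpow_eq_rpow_re_of_pos ht, Complex.norm_exp]
  simp

lemma continuousOn_cpow_mul_cexp_neg (s r : ℂ) :
    ContinuousOn (fun t : ℝ => (t : ℂ) ^ (s - 1) * Complex.exp (-(r * t))) (Ioi 0) := by
  intro t ht
  have h : ContinuousAt (fun t : ℝ => (t : ℂ) ^ (s - 1)) t :=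
    Complex.continuousAt_ofReal_cpow_const _ _ (Or.inr (ne_of_gt ht))
  exact (h.mul (by fun_prop)).continuousWithinAt

lemma integrableOn_cpow_mul_cexp_neg {s r : ℂ} (hs : 0 < s.re) (hr : 0 < r.re) :
    IntegrableOn (fun t : ℝ => (t : ℂ) ^ (s - 1) * Complex.exp (-(r * t))) (Ioi 0) := by
  refine (integrableOn_rpow_mul_exp_neg_mul hs hr).mono'
    ((continuousOn_cpow_mul_cexp_neg s r).aestronglyMeasurable measurableSet_Ioi) ?_
  filter_upwards [ae_restrict_mem measurableSet_Ioi] with t ht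
  exact (norm_cpow_mul_cexp_neg ht).le

lemma differentiableAt_integral_cpow_mul_cexp_neg {s r : ℂ} (hs : 0 < s.re) (hr : 0 < r.re) :
    DifferentiableAt ℂ
      (fun r : ℂ => ∫ t : ℝ in Ioi 0, (t : ℂ) ^ (s - 1) * Complex.exp (-(r * t))) r := by
  -- On this half-plane |e^(-zt)| ≤ e^(-t Re r / 2), which dominates the derivative uniformly.
  have hU : {z : ℂ | r.re / 2 < z.re} ∈ 𝓝 r :=
    (isOpen_lt continuous_const Complex.continuous_re).mem_nhds (by simp; linarith)
  refine (hasDerivAt_integral_of_dominated_loc_of_deriv_le (μ := volume.restrict (Ioi (0 : ℝ)))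
    (F := fun (z : ℂ) (t : ℝ) => (t : ℂ) ^ (s - 1) * Complex.exp (-(z * t)))
    (F' := fun (z : ℂ) (t : ℝ) => (t : ℂ) ^ (s - 1) * (Complex.exp (-(z * t)) * -t))
    (bound := fun t : ℝ => t ^ (s.re + 1 - 1) * Real.exp (-(r.re / 2 * t)))
    hU ?_ (integrableOn_cpow_mul_cexp_neg hs hr) ?_ ?_ ?_ ?_).2.differentiableAt
  · exact Eventually.of_forall fun z =>
      (continuousOn_cpow_mul_cexp_neg s z).aestronglyMeasurable measurableSet_Ioi
  · refine (((continuousOn_cpow_mul_cexp_neg s r).mul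
      (f := fun t : ℝ => (t : ℂ) ^ (s - 1) * Complex.exp (-(r * t)))
      (g := fun t : ℝ => -(t : ℂ)) (by fun_prop)).congr
        (fun t _ => ?_)).aestronglyMeasurable measurableSet_Ioi
    simp only [Pi.mul_apply]; ring
  · filter_upwards [ae_restrict_mem measurableSet_Ioi] with t ht z hz
    have ht' : 0 < t := ht
    rw [← mul_assoc, norm_mul, norm_cpow_mul_cexp_neg ht', norm_neg, Complex.norm_real,
      Real.norm_of_nonneg ht'.le, mul_right_comm, ← Real.rpow_add_one ht'.ne']
    rw [show s.re - 1 + 1 = s.re + 1 - 1 by ring]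
    have hz' : r.re / 2 ≤ z.re := le_of_lt hz
    gcongr
  · exact integrableOn_rpow_mul_exp_neg_mul (by linarith) (by linarith)
  · refine Eventually.of_forall fun t z _ => ?_
    have h1 : HasDerivAt (fun z : ℂ => -(z * t)) (-t : ℂ) z := by
      simpa using (hasDerivAt_mul_const (x := z) (t : ℂ)).fun_neg
    exact (h1.cexp).const_mul _

/-- The Gamma integral along a rotated ray. -/
lemma integral_cpow_mul_cexp_neg_mul_Ioi {s r : ℂ} (hs : 0 < s.re) (hr : 0 < r.re) :
    ∫ t : ℝ in Ioi 0, (t : ℂ) ^ (s - 1) * Complex.exp (-(r * t))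
      = (1 / r) ^ s * Complex.Gamma s := by
  have hU : IsOpen {z : ℂ | 0 < z.re} := isOpen_lt continuous_const Complex.continuous_re
  have hf : AnalyticOnNhd ℂ
      (fun r : ℂ => ∫ t : ℝ in Ioi 0, (t : ℂ) ^ (s - 1) * Complex.exp (-(r * t)))
      {z : ℂ | 0 < z.re} := DifferentiableOn.analyticOnNhd
    (fun z hz => (differentiableAt_integral_cpow_mul_cexp_neg hs hz).differentiableWithinAt) hU
  have hg : AnalyticOnNhd ℂ (fun r : ℂ => (1 / r) ^ s * Complex.Gamma s) {z : ℂ | 0 < z.re} := by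
    refine DifferentiableOn.analyticOnNhd (fun z hz => ?_) hU
    have hz' : 0 < z.re := hz
    have hz0 : z ≠ 0 := by rintro rfl; simp at hz'
    refine DifferentiableAt.differentiableWithinAt ?_
    refine DifferentiableAt.mul_const ?_ _
    refine DifferentiableAt.cpow (by fun_prop (disch := assumption)) (by fun_prop) ?_
    refine Or.inl ?_
    rw [one_div, Complex.inv_re]
    exact div_pos hz' (Complex.normSq_pos.2 hz0)
  -- Identity theorem: the formula is known for real r > 0, and the real points 1 + 1/(n+1)
  -- accumulate at 1.
  refine hf.eqOn_of_preconnected_of_frequently_eq hg (convex_halfSpace_re_gt 0).isPreconnected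
    (z₀ := 1) (by simp) ?_ hr
  have h1 : Tendsto (fun n : ℕ => (((1 + 1 / ((n : ℝ) + 1) : ℝ)) : ℂ)) atTop (𝓝[≠] 1) := by
    refine tendsto_nhdsWithin_iff.2 ⟨?_, Eventually.of_forall fun n => ?_⟩
    · have := (tendsto_one_div_add_atTop_nhds_zero_nat (𝕜 := ℝ)).const_add 1
      rw [add_zero] at this
      exact_mod_cast (Complex.continuous_ofReal.tendsto 1).comp this
    · have : (1 + 1 / ((n : ℝ) + 1)) ≠ 1 := by
        have : 0 < 1 / ((n : ℝ) + 1) := by positivity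
        linarith
      simpa only [mem_compl_iff, mem_singleton_iff, Complex.ofReal_eq_one] using this
  refine h1.frequently (Frequently.of_forall fun n => ?_)
  exact Complex.integral_cpow_mul_exp_neg_mul_Ioi hs (by positivity)

lemma mellin_cexp_neg {s r : ℂ} (hs : 0 < s.re) (hr : 0 < r.re) :
    mellin (fun t : ℝ => Complex.exp (-(r * t))) s = (1 / r) ^ s * Complex.Gamma s := by
  simp_rw [mellin, smul_eq_mul]
  exact integral_cpow_mul_cexp_neg_mul_Ioi hs hr

/-! ### Plancherel and the total mass of the weight -/

/-- Plancherel's identity for a continuous integrable function with integrable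
Fourier transform. -/
lemma integral_norm_sq_fourier_of_integrable {f : ℝ → ℂ} (hc : Continuous f) (hf : Integrable f)
    (hF : Integrable (𝓕 f)) : ∫ x, ‖𝓕 f x‖ ^ 2 = ∫ x, ‖f x‖ ^ 2 := by
  have h := VectorFourier.integral_sesq_fourierIntegral_eq_neg_flip (μ := volume) (ν := volume)
    (L := innerₗ ℝ) (e := Real.fourierChar) (innerSL ℂ (E := ℂ)) Real.continuous_fourierChar
    continuous_inner hf hF
  have h2 : ∀ x, VectorFourier.fourierIntegral Real.fourierChar volume (-(innerₗ ℝ).flip) (𝓕 f) x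
      = f x := by
    intro x
    conv_rhs => rw [← hc.fourierInv_fourier_eq hf hF]
    simp [VectorFourier.fourierIntegral, Real.fourierInv_eq]
  simp_rw [h2] at h
  have h3 : ∀ z : ℂ, innerSL ℂ z z = ((‖z‖ ^ 2 : ℝ) : ℂ) := by
    intro z
    rw [innerSL_apply_apply, inner_self_eq_norm_sq_to_K]; simp
  change ∫ x, innerSL ℂ (𝓕 f x) (𝓕 f x) = _ at h
  simp_rw [h3] at h
  rw [integral_complex_ofReal, integral_complex_ofReal] at h
  exact_mod_cast h

lemma integrable_of_mul_exp_le {f : ℝ → ℝ} (hf : AEStronglyMeasurable f) (h0 : ∀ x, 0 ≤ f x)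
    {ε C D : ℝ} (hε : 0 < ε) (hC : ∀ x, f x * Real.exp (ε * x) ≤ C)
    (hD : ∀ x, f x * Real.exp (-ε * x) ≤ D) : Integrable f := by
  have hg : Integrable fun x : ℝ => (C + D) * (1 + (ε / 2 * x) ^ 2)⁻¹ :=
    (integrable_inv_one_add_sq.comp_mul_left' (by positivity : ε / 2 ≠ 0)).const_mul _
  refine hg.mono' hf (Eventually.of_forall fun x => ?_)
  rw [Real.norm_of_nonneg (h0 x), ← div_eq_mul_inv, le_div_iff₀ (by positivity)]
  have key : 1 + (ε / 2 * x) ^ 2 ≤ Real.exp (ε * x) + Real.exp (-ε * x) := by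
    rcases le_total 0 (ε * x) with h | h
    · have := Real.quadratic_le_exp_of_nonneg h
      nlinarith [Real.exp_pos (-ε * x), sq_nonneg (ε * x)]
    · have := Real.quadratic_le_exp_of_nonneg (x := -ε * x) (by linarith)
      nlinarith [Real.exp_pos (ε * x), sq_nonneg (ε * x)]
  calc f x * (1 + (ε / 2 * x) ^ 2)
      ≤ f x * (Real.exp (ε * x) + Real.exp (-ε * x)) := mul_le_mul_of_nonneg_left key (h0 x)
    _ ≤ C + D := by rw [mul_add]; exact add_le_add (hC x) (hD x)

lemma integral_exp_mul_exp_neg_exp {a c : ℝ} (ha : 0 < a) (hc : 0 < c) :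
    ∫ u : ℝ, Real.exp (-a * u) * Real.exp (-(c * Real.exp (-u))) = (1 / c) ^ a * Real.Gamma a := by
  have h := mellin_cexp_neg (s := (a : ℂ)) (r := (c : ℂ)) (by simpa) (by simpa)
  rw [mellin_eq_fourier] at h
  simp only [Complex.ofReal_im, zero_div, Complex.ofReal_re, Real.fourier_eq, inner_zero_right,
    neg_zero, AddChar.map_zero_eq_one, one_smul] at h
  rw [← Complex.ofReal_inj, ← integral_complex_ofReal]
  rw [Complex.Gamma_ofReal] at h
  rw [Complex.ofReal_mul, Complex.ofReal_cpow (by positivity)]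
  push_cast
  rw [← h]
  refine integral_congr_ae (Eventually.of_forall fun u => ?_)
  simp

lemma integrable_exp_mul_exp_neg_exp {a c : ℝ} (ha : 0 < a) (hc : 0 < c) :
    Integrable fun u : ℝ => Real.exp (-a * u) * Real.exp (-(c * Real.exp (-u))) := by
  -- The Bochner integral of a non-integrable function is 0 by convention, so a nonzero value proves
  -- integrability.
  apply Integrable.of_integral_ne_zero
  rw [integral_exp_mul_exp_neg_exp ha hc]
  have := Real.Gamma_pos_of_pos ha
  positivity

/-- The function whose Fourier transform is `e^{θx} Γ(lam + ix)`, up to scaling and a constant of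
modulus one, for `r = e^{iθ}`. -/
noncomputable def gammaKernel (lam : ℝ) (r : ℂ) (u : ℝ) : ℂ :=
  Real.exp (-lam * u) • Complex.exp (-(r * Real.exp (-u)))

lemma continuous_gammaKernel (lam : ℝ) (r : ℂ) : Continuous (gammaKernel lam r) := by
  unfold gammaKernel; fun_prop

lemma norm_gammaKernel (lam : ℝ) (r : ℂ) (u : ℝ) : ‖gammaKernel lam r u‖
    = Real.exp (-lam * u) * Real.exp (-(r.re * Real.exp (-u))) := by
  rw [gammaKernel, norm_smul, Complex.norm_exp, Real.norm_of_nonneg (Real.exp_pos _).le,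
    Complex.neg_re, Complex.re_mul_ofReal]

lemma integrable_gammaKernel {lam : ℝ} {r : ℂ} (hlam : 0 < lam) (hr : 0 < r.re) :
    Integrable (gammaKernel lam r) := by
  rw [← integrable_norm_iff (continuous_gammaKernel lam r).aestronglyMeasurable]
  simp_rw [norm_gammaKernel]
  exact integrable_exp_mul_exp_neg_exp hlam hr

lemma integral_norm_sq_gammaKernel {lam : ℝ} {r : ℂ} (hlam : 0 < lam) (hr : 0 < r.re) :
    ∫ u, ‖gammaKernel lam r u‖ ^ 2 = (1 / (2 * r.re)) ^ (2 * lam) * Real.Gamma (2 * lam) := by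
  rw [← integral_exp_mul_exp_neg_exp (by positivity : 0 < 2 * lam) (by positivity)]
  congr 1 with u
  rw [norm_gammaKernel, mul_pow, ← Real.exp_nat_mul, ← Real.exp_nat_mul]
  congr 2 <;> push_cast <;> ring

/-- The substitution t = e^(-u) turns the Mellin transform r^(-s) Γ(s), s = λ + ix, into a Fourier
transform. For r = e^(iθ), |r^(-s)| = e^(θx); the range of θ ensures Re r > 0. -/
lemma norm_fourier_gammaKernel {lam θ : ℝ} (hlam : 0 < lam) (h1 : -(Real.pi / 2) < θ)
    (h2 : θ < Real.pi / 2) (x : ℝ) :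
    ‖𝓕 (gammaKernel lam (Complex.exp (θ * Complex.I))) (x / (2 * Real.pi))‖
      = Real.exp (θ * x) * ‖Complex.Gamma (lam + Complex.I * x)‖ := by
  have hr : 0 < (Complex.exp (θ * Complex.I)).re := by
    rw [Complex.exp_ofReal_mul_I_re]; exact Real.cos_pos_of_mem_Ioo ⟨h1, h2⟩
  have h := mellin_cexp_neg (s := (lam + Complex.I * x : ℂ)) (by simpa) hr
  rw [mellin_eq_fourier] at h
  have him : (lam + Complex.I * x : ℂ).im = x := by simp
  have hre : (lam + Complex.I * x : ℂ).re = lam := by simp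
  rw [him, hre] at h
  change 𝓕 (gammaKernel lam (Complex.exp (θ * Complex.I))) (x / (2 * Real.pi)) = _ at h
  rw [h, norm_mul, one_div, ← Complex.exp_neg, Complex.cpow_def_of_ne_zero (Complex.exp_ne_zero _),
    Complex.log_exp (by simp; linarith [Real.pi_pos]) (by simp; linarith [Real.pi_pos]),
    Complex.norm_exp]
  simp

lemma continuous_norm_Gamma_vertical {lam : ℝ} (hlam : 0 < lam) :
    Continuous fun x : ℝ => ‖Complex.Gamma (lam + Complex.I * x)‖ := by
  refine Continuous.norm (continuous_iff_continuousAt.2 fun x => ?_)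
  have h : ContinuousAt Complex.Gamma ((lam : ℂ) + Complex.I * (x : ℂ)) := by
    refine (Complex.differentiableAt_Gamma _ fun m hm => ?_).continuousAt
    have := congrArg Complex.re hm
    simp at this
    linarith [(Nat.cast_nonneg m : (0 : ℝ) ≤ m)]
  exact ContinuousAt.comp (f := fun x : ℝ => (lam : ℂ) + Complex.I * (x : ℂ)) h (by fun_prop)

lemma exists_exp_mul_norm_Gamma_le {lam θ : ℝ} (hlam : 0 < lam) (h1 : -(Real.pi / 2) < θ)
    (h2 : θ < Real.pi / 2) :
    ∃ C, ∀ x : ℝ, Real.exp (θ * x) * ‖Complex.Gamma (lam + Complex.I * x)‖ ≤ C := by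
  refine ⟨∫ u, ‖gammaKernel lam (Complex.exp (θ * Complex.I)) u‖, fun x => ?_⟩
  rw [← norm_fourier_gammaKernel hlam h1 h2]
  exact VectorFourier.norm_fourierIntegral_le_integral_norm _ _ _ _ _

/-- The uniform bounds at θ + ε and θ - ε amount to exponential decay at both ends. -/
lemma integrable_exp_mul_norm_Gamma {lam θ : ℝ} (hlam : 0 < lam) (h1 : -(Real.pi / 2) < θ)
    (h2 : θ < Real.pi / 2) :
    Integrable fun x : ℝ => Real.exp (θ * x) * ‖Complex.Gamma (lam + Complex.I * x)‖ := by
  obtain ⟨ε, hε, hε1, hε2⟩ : ∃ ε > 0, θ + ε < Real.pi / 2 ∧ -(Real.pi / 2) < θ - ε := by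
    refine ⟨min (Real.pi / 2 - θ) (θ + Real.pi / 2) / 2, ?_, ?_, ?_⟩
    · have : 0 < min (Real.pi / 2 - θ) (θ + Real.pi / 2) := lt_min (by linarith) (by linarith)
      positivity
    · linarith [min_le_left (Real.pi / 2 - θ) (θ + Real.pi / 2)]
    · linarith [min_le_right (Real.pi / 2 - θ) (θ + Real.pi / 2)]
  obtain ⟨C, hC⟩ := exists_exp_mul_norm_Gamma_le (θ := θ + ε) hlam (by linarith) hε1
  obtain ⟨D, hD⟩ := exists_exp_mul_norm_Gamma_le (θ := θ - ε) hlam hε2 (by linarith)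
  refine integrable_of_mul_exp_le ?_ (fun x => by positivity) hε (C := C) (D := D)
    (fun x => ?_) (fun x => ?_)
  · exact ((by fun_prop : Continuous fun x : ℝ => Real.exp (θ * x)).mul
      (continuous_norm_Gamma_vertical hlam)).aestronglyMeasurable
  · refine le_trans (le_of_eq ?_) (hC x)
    rw [mul_right_comm, ← Real.exp_add]; ring_nf
  · refine le_trans (le_of_eq ?_) (hD x)
    rw [mul_right_comm, ← Real.exp_add]; ring_nf

lemma meixnerPollaczekWeight_eq (lam φ x : ℝ) : meixnerPollaczekWeight lam φ x
    = (Real.exp ((φ - Real.pi / 2) * x) * ‖Complex.Gamma (lam + Complex.I * x)‖) ^ 2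
      / (2 * Real.pi) := by
  rw [meixnerPollaczekWeight, mul_pow, ← Real.exp_nat_mul]
  congr 3
  push_cast; ring

lemma integrable_meixnerPollaczekWeight {lam φ : ℝ} (hlam : 0 < lam) (hφ0 : 0 < φ)
    (hφπ : φ < Real.pi) : Integrable (meixnerPollaczekWeight lam φ) := by
  obtain ⟨C, hC⟩ := exists_exp_mul_norm_Gamma_le (θ := φ - Real.pi / 2) hlam (by linarith)
    (by linarith)
  have h := integrable_exp_mul_norm_Gamma (θ := φ - Real.pi / 2) hlam (by linarith) (by linarith)
  have h2 := (h.mul_bdd (c := C) h.aestronglyMeasurable (Eventually.of_forall fun x => by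
    rw [Real.norm_of_nonneg (by positivity)]; exact hC x)).div_const (2 * Real.pi)
  refine h2.congr (Eventually.of_forall fun x => ?_)
  simp only
  rw [meixnerPollaczekWeight_eq, sq]

/-- Plancherel for the kernel with θ = φ - π/2, for which Re r = cos θ = sin φ. The dilation by 2π
cancels the 1/(2π) in the weight. -/
lemma integral_meixnerPollaczekWeight {lam φ : ℝ} (hlam : 0 < lam) (hφ0 : 0 < φ)
    (hφπ : φ < Real.pi) : ∫ x, meixnerPollaczekWeight lam φ x
      = (1 / (2 * Real.sin φ)) ^ (2 * lam) * Real.Gamma (2 * lam) := by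
  have h1 : -(Real.pi / 2) < φ - Real.pi / 2 := by linarith
  have h2 : φ - Real.pi / 2 < Real.pi / 2 := by linarith
  set r := Complex.exp ((φ - Real.pi / 2 : ℝ) * Complex.I) with hrdef
  have hr : r.re = Real.sin φ := by
    rw [hrdef, Complex.exp_ofReal_mul_I_re, Real.cos_sub_pi_div_two]
  have hr0 : 0 < r.re := hr ▸ Real.sin_pos_of_pos_of_lt_pi hφ0 hφπ
  have hw : ∀ x, meixnerPollaczekWeight lam φ x
      = (2 * Real.pi)⁻¹ * ‖𝓕 (gammaKernel lam r) (x / (2 * Real.pi))‖ ^ 2 := by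
    intro x
    rw [norm_fourier_gammaKernel hlam h1 h2, meixnerPollaczekWeight_eq, div_eq_inv_mul]
  have hF : Integrable (𝓕 (gammaKernel lam r)) := by
    have hc : Continuous (𝓕 (gammaKernel lam r)) :=
      VectorFourier.fourierIntegral_continuous Real.continuous_fourierChar continuous_inner
        (integrable_gammaKernel hlam hr0)
    rw [← integrable_norm_iff hc.aestronglyMeasurable]
    have h := (integrable_exp_mul_norm_Gamma hlam h1 h2).comp_mul_right'
      (by positivity : 2 * Real.pi ≠ 0)
    refine h.congr (Eventually.of_forall fun x => ?_)
    simp only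
    rw [← norm_fourier_gammaKernel hlam h1 h2, mul_div_cancel_right₀ _ (by positivity)]
  simp_rw [hw]
  rw [integral_const_mul, Measure.integral_comp_div (fun y => ‖𝓕 (gammaKernel lam r) y‖ ^ 2),
    integral_norm_sq_fourier_of_integrable (continuous_gammaKernel lam r)
      (integrable_gammaKernel hlam hr0) hF, integral_norm_sq_gammaKernel hlam hr0, hr,
    smul_eq_mul, abs_of_pos (by positivity), inv_mul_cancel_left₀ (by positivity)]

/-! ### Contiguous relation for the terminating ₂F₁ -/

open Polynomial

lemma ascPochhammer_eval_sub_one_succ (a : ℂ) (k : ℕ) :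
    (ascPochhammer ℂ (k + 1)).eval (a - 1) = (a - 1) * (ascPochhammer ℂ k).eval a := by
  rw [ascPochhammer_succ_left]
  simp [eval_comp]

lemma mul_ascPochhammer_eval_add_one (a : ℂ) (k : ℕ) :
    a * (ascPochhammer ℂ k).eval (a + 1) = (ascPochhammer ℂ k).eval a * (a + k) := by
  have h := ascPochhammer_eval_sub_one_succ (a + 1) k
  rw [add_sub_cancel_right] at h
  rw [← h, ascPochhammer_succ_eval]

/-- The partial sums of the Gauss hypergeometric series. -/
noncomputable def hypergeometricPartialSum (b c z a : ℂ) (N : ℕ) : ℂ :=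
  ∑ k ∈ Finset.range N, (ascPochhammer ℂ k).eval a *
    (((k.factorial : ℂ)⁻¹ * (ascPochhammer ℂ k).eval b * ((ascPochhammer ℂ k).eval c)⁻¹) * z ^ k)

/-- Gauss's contiguous relation in the first parameter, for partial sums. -/
lemma hypergeometricPartialSum_contiguous {b c z : ℂ} (hc : ∀ k : ℕ, c + k ≠ 0) (a : ℂ) (N : ℕ) :
    (c - a) * hypergeometricPartialSum b c z (a - 1) (N + 1)
      + (2 * a - c + (b - a) * z) * hypergeometricPartialSum b c z a (N + 1)
      + a * (z - 1) * hypergeometricPartialSum b c z (a + 1) (N + 1)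
    = (ascPochhammer ℂ N).eval a * (b + N) *
      (((N.factorial : ℂ)⁻¹ * (ascPochhammer ℂ N).eval b * ((ascPochhammer ℂ N).eval c)⁻¹)
        * z ^ N) * z := by
  induction N with
  | zero => simp [hypergeometricPartialSum]; ring
  | succ N ih =>
    -- The ratio of consecutive coefficients, denominators cleared; it absorbs the old boundary term
    -- into the new one.
    have hT : ((((N + 1).factorial : ℂ)⁻¹ * (ascPochhammer ℂ (N + 1)).eval b *
        ((ascPochhammer ℂ (N + 1)).eval c)⁻¹) * z ^ (N + 1)) * ((c + N) * (N + 1))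
        = (((N.factorial : ℂ)⁻¹ * (ascPochhammer ℂ N).eval b * ((ascPochhammer ℂ N).eval c)⁻¹)
          * z ^ N) * z * (b + N) := by
      have hN : (N + 1 : ℂ) ≠ 0 := by exact_mod_cast N.succ_ne_zero
      have := hc N
      rw [ascPochhammer_succ_eval, ascPochhammer_succ_eval, Nat.factorial_succ, mul_inv]
      push_cast
      rw [mul_inv]
      field_simp
      ring
    simp only [hypergeometricPartialSum] at ih ⊢
    rw [Finset.sum_range_succ _ (N + 1), Finset.sum_range_succ _ (N + 1),
      Finset.sum_range_succ _ (N + 1)]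
    set T := ((((N + 1).factorial : ℂ)⁻¹ * (ascPochhammer ℂ (N + 1)).eval b *
        ((ascPochhammer ℂ (N + 1)).eval c)⁻¹) * z ^ (N + 1))
    rw [ascPochhammer_eval_sub_one_succ a N]
    have h1 := mul_ascPochhammer_eval_add_one a (N + 1)
    have h2 := ascPochhammer_succ_eval N a
    rw [h2] at h1 ⊢
    push_cast at h1 ⊢
    linear_combination ih + (z - 1) * T * h1 - (ascPochhammer ℂ N).eval a * hT

lemma ordinaryHypergeometric_neg_nat_eq (n N : ℕ) (hN : n < N) (b c z : ℂ) :
    ordinaryHypergeometric (-(n : ℂ)) b c z = hypergeometricPartialSum b c z (-n) N := by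
  rw [ordinaryHypergeometric_eq_tsum, hypergeometricPartialSum]
  beta_reduce
  rw [tsum_eq_sum (s := Finset.range N)]
  · refine Finset.sum_congr rfl fun k _ => ?_
    rw [smul_eq_mul]; ring
  · intro k hk
    rw [Finset.mem_range, not_lt] at hk
    rw [(ascPochhammer_eval_eq_zero_iff k (-(n : ℂ))).2 ⟨n, by omega, by simp⟩]
    simp

/-- The contiguous relation at a = -(n+1): with n + 3 terms all three series are complete, and the
boundary term vanishes because (-(n+1))_(n+2) = 0. -/
lemma ordinaryHypergeometric_neg_nat_recurrence {b c : ℂ} (hc : ∀ k : ℕ, c + k ≠ 0) (z : ℂ)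
    (n : ℕ) :
    (c + (n + 1)) * ordinaryHypergeometric (-((n + 2 : ℕ) : ℂ)) b c z
      - (2 * (n + 1) + c - (n + 1 + b) * z) * ordinaryHypergeometric (-((n + 1 : ℕ) : ℂ)) b c z
      + (n + 1) * (1 - z) * ordinaryHypergeometric (-(n : ℂ)) b c z = 0 := by
  rw [ordinaryHypergeometric_neg_nat_eq (n + 2) (n + 3) (by omega),
    ordinaryHypergeometric_neg_nat_eq (n + 1) (n + 3) (by omega),
    ordinaryHypergeometric_neg_nat_eq n (n + 3) (by omega)]
  have h := hypergeometricPartialSum_contiguous (b := b) (z := z) hc (-((n + 1 : ℕ) : ℂ)) (n + 2)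
  rw [(ascPochhammer_eval_eq_zero_iff (n + 2) (-((n + 1 : ℕ) : ℂ))).2 ⟨n + 1, by omega, by simp⟩]
    at h
  rw [show (-((n + 1 : ℕ) : ℂ)) - 1 = -((n + 2 : ℕ) : ℂ) by push_cast; ring,
    show (-((n + 1 : ℕ) : ℂ)) + 1 = -(n : ℂ) by push_cast; ring] at h
  push_cast at h ⊢
  linear_combination h

lemma ordinaryHypergeometric_neg_zero (b c z : ℂ) :
    ordinaryHypergeometric (-((0 : ℕ) : ℂ)) b c z = 1 := by
  rw [ordinaryHypergeometric_neg_nat_eq 0 1 one_pos]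
  simp [hypergeometricPartialSum]

lemma ordinaryHypergeometric_neg_one (b c z : ℂ) :
    ordinaryHypergeometric (-((1 : ℕ) : ℂ)) b c z = 1 - b / c * z := by
  rw [ordinaryHypergeometric_neg_nat_eq 1 2 (by omega)]
  simp [hypergeometricPartialSum, Finset.sum_range_succ]
  ring

/-! ### Three-term recurrence and reality -/

/-- The Meixner–Pollaczek polynomials as elements of `ℝ[X]`, given by their three-term
recurrence. -/
noncomputable def mpPoly (lam φ : ℝ) : ℕ → ℝ[X]
  | 0 => 1
  | 1 => C (2 * Real.sin φ) * X + C (2 * lam * Real.cos φ)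
  | n + 2 => C (1 / ((n : ℝ) + 2)) * ((C (2 * Real.sin φ) * X
      + C (2 * ((n : ℝ) + 1 + lam) * Real.cos φ)) * mpPoly lam φ (n + 1)
      - C ((n : ℝ) + 2 * lam) * mpPoly lam φ n)

/-- The predecessor `P_{n-1}` of `P_n`, with `P_{-1} = 0`. -/
noncomputable def mpPrev (lam φ : ℝ) : ℕ → ℝ[X]
  | 0 => 0
  | n + 1 => mpPoly lam φ n

lemma mpPrev_succ (lam φ : ℝ) (n : ℕ) : mpPrev lam φ (n + 1) = mpPoly lam φ n := rfl

lemma mpPoly_add_two (lam φ : ℝ) (n : ℕ) : C ((n : ℝ) + 2) * mpPoly lam φ (n + 2)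
    = (C (2 * Real.sin φ) * X + C (2 * ((n : ℝ) + 1 + lam) * Real.cos φ)) * mpPoly lam φ (n + 1)
      - C ((n : ℝ) + 2 * lam) * mpPoly lam φ n := by
  have : (n : ℝ) + 2 ≠ 0 := by positivity
  rw [mpPoly, ← mul_assoc, ← C_mul, mul_one_div_cancel this, C_1, one_mul]

lemma mpPoly_succ (lam φ : ℝ) (n : ℕ) : C ((n : ℝ) + 1) * mpPoly lam φ (n + 1)
    = (C (2 * Real.sin φ) * X + C (2 * ((n : ℝ) + lam) * Real.cos φ)) * mpPoly lam φ n
      - C ((n : ℝ) + 2 * lam - 1) * mpPrev lam φ n := by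
  cases n with
  | zero => simp [mpPoly, mpPrev]
  | succ n =>
    have h := mpPoly_add_two lam φ n
    rw [mpPrev]
    push_cast
    rw [show (n : ℝ) + 1 + 1 = n + 2 by ring, h,
      show (n : ℝ) + 1 + 2 * lam - 1 = n + 2 * lam by ring]

/-- With w = e^(iφ) the argument is 1 - w⁻², and the hypergeometric recurrence, scaled by (2λ)_n wⁿ
/ n!, becomes the real one. The initial values agree. -/
lemma meixnerPollaczekComplex_eq {lam : ℝ} (hlam : 0 < lam) (φ x : ℝ) (n : ℕ) :
    meixnerPollaczekComplex lam n φ x = (((mpPoly lam φ n).eval x : ℝ) : ℂ) := by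
  have hc : ∀ k : ℕ, (2 * lam : ℂ) + k ≠ 0 := by
    intro k h
    have h' : 2 * lam + (k : ℝ) = 0 := by exact_mod_cast h
    have : 0 < 2 * lam + (k : ℝ) := by positivity
    exact this.ne' h'
  set w := Complex.exp (Complex.I * φ) with hw
  have hw0 : w ≠ 0 := Complex.exp_ne_zero _
  have hz : Complex.exp (-2 * Complex.I * φ) = (w⁻¹) ^ 2 := by
    rw [hw, ← Complex.exp_neg, ← Complex.exp_nat_mul]; congr 1; push_cast; ring
  have hwn : ∀ n : ℕ, Complex.exp (Complex.I * n * φ) = w ^ n := by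
    intro n
    rw [hw, ← Complex.exp_nat_mul]; congr 1; ring
  have hcos : (2 * Real.cos φ : ℂ) = w + w⁻¹ := by
    rw [hw, ← Complex.exp_neg, Complex.ofReal_cos, Complex.cos]
    ring_nf
  have hsin : (2 * Real.sin φ : ℂ) = -Complex.I * (w - w⁻¹) := by
    rw [hw, ← Complex.exp_neg, Complex.ofReal_sin, Complex.sin]
    ring_nf
  induction n using Nat.strong_induction_on with
  | _ n ih =>
    match n, ih with
    | 0, _ =>
      rw [meixnerPollaczekComplex, ordinaryHypergeometric_neg_zero]
      simp [mpPoly]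
    | 1, _ =>
      rw [meixnerPollaczekComplex, ordinaryHypergeometric_neg_one, hwn, hz]
      have := hc 0
      simp only [mpPoly, eval_add, eval_mul, eval_C, eval_X]
      push_cast at this hcos hsin ⊢
      rw [hsin, show (2 * lam * Complex.cos φ : ℂ) = lam * (2 * Complex.cos φ) by ring, hcos]
      simp only [ascPochhammer_one, eval_X, Nat.factorial]
      rw [add_zero] at this
      have hl : (lam : ℂ) ≠ 0 := by simpa using this
      push_cast
      field_simp
      ring
    | n + 2, ih =>
      have i1 := ih (n + 1) (by omega)
      have i0 := ih n (by omega)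
      have hR := congrArg (fun p : ℝ[X] => ((p.eval x : ℝ) : ℂ)) (mpPoly_add_two lam φ n)
      simp only [eval_sub, eval_add, eval_mul, eval_C, eval_X] at hR
      push_cast at hR
      rw [← i1, ← i0] at hR
      have hn2 : (n + 2 : ℂ) ≠ 0 := by exact_mod_cast (n + 1).succ_ne_zero
      have hn1 : (n + 1 : ℂ) ≠ 0 := by exact_mod_cast n.succ_ne_zero
      refine mul_left_cancel₀ hn2 (Eq.trans ?_ hR.symm)
      have hrec := ordinaryHypergeometric_neg_nat_recurrence (b := lam + Complex.I * x) hc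
        (1 - (w⁻¹) ^ 2) n
      push_cast at hcos hsin
      rw [hsin, show (2 * (n + 1 + lam) * Complex.cos φ : ℂ)
        = (n + 1 + lam) * (2 * Complex.cos φ) by ring, hcos]
      simp only [meixnerPollaczekComplex, hwn, hz]
      set F2 := ordinaryHypergeometric (-((n + 2 : ℕ) : ℂ)) (lam + Complex.I * x : ℂ)
        (2 * lam : ℂ) (1 - w⁻¹ ^ 2)
      set F1 := ordinaryHypergeometric (-((n + 1 : ℕ) : ℂ)) (lam + Complex.I * x : ℂ)
        (2 * lam : ℂ) (1 - w⁻¹ ^ 2)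
      set F0 := ordinaryHypergeometric (-(n : ℂ)) (lam + Complex.I * x : ℂ)
        (2 * lam : ℂ) (1 - w⁻¹ ^ 2)
      rw [ascPochhammer_succ_eval (n + 1), ascPochhammer_succ_eval n, Nat.factorial_succ (n + 1),
        Nat.factorial_succ n]
      have hf : (n.factorial : ℂ) ≠ 0 := by exact_mod_cast n.factorial_ne_zero
      push_cast
      rw [show (n + 1 + 1 : ℂ) = n + 2 by ring]
      have e : w ^ (n + 2) = w ^ n * w ^ 2 := by ring
      have e1 : w ^ (n + 1) = w ^ n * w := by ring
      rw [e, e1]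
      generalize w ^ n = W at *
      generalize eval (2 * (lam : ℂ)) (ascPochhammer ℂ n) = A at *
      have key : (2 * lam + (n + 1 : ℂ)) * F2 = (2 * (n + 1) + 2 * lam
        - (n + 1 + (lam + Complex.I * x)) * (1 - w⁻¹ ^ 2)) * F1 - (n + 1) * w⁻¹ ^ 2 * F0 := by
        linear_combination hrec
      have k2 : ((n : ℂ) + 2) * (A * (2 * lam + n) * (2 * lam + (n + 1))
          / ((n + 2) * ((n + 1) * n.factorial)) * (W * w ^ 2) * F2)
          = A * (2 * lam + n) / ((n + 1) * n.factorial) * (W * w ^ 2)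
            * ((2 * lam + (n + 1 : ℂ)) * F2) := by
        field_simp
      rw [k2, key]
      field_simp
      ring

lemma meixnerPollaczek_eq {lam : ℝ} (hlam : 0 < lam) (φ x : ℝ) (n : ℕ) :
    meixnerPollaczek lam n φ x = (mpPoly lam φ n).eval x := by
  rw [meixnerPollaczek, meixnerPollaczekComplex_eq hlam, Complex.ofReal_re]

/-! ### Differentiation in φ -/

/-- The derivative of `P_n` with respect to `φ`:
`sin φ ∂P_n/∂φ = n cos φ P_n - (n + 2lam - 1) P_{n-1}`. -/
noncomputable def mpDeriv (lam φ : ℝ) (n : ℕ) : ℝ[X] :=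
  C (1 / Real.sin φ) * (C (n * Real.cos φ) * mpPoly lam φ n
    - C ((n : ℝ) + 2 * lam - 1) * mpPrev lam φ n)

lemma mpDeriv_zero (lam φ : ℝ) : mpDeriv lam φ 0 = 0 := by
  simp [mpDeriv, mpPrev]

lemma mpDeriv_one (lam : ℝ) {φ : ℝ} (hφ : Real.sin φ ≠ 0) :
    mpDeriv lam φ 1 = C (2 * Real.cos φ) * X - C (2 * lam * Real.sin φ) := by
  refine Polynomial.funext fun x => ?_
  simp only [mpDeriv, mpPoly, mpPrev, eval_add, eval_sub, eval_mul, eval_C, eval_X, eval_one]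
  field_simp
  push_cast
  linear_combination (2 * lam) * Real.sin_sq_add_cos_sq φ

/-- This is the φ-derivative of the recurrence; it lets induction identify the closed form with the
true derivative. -/
lemma mpDeriv_add_two (lam : ℝ) {φ : ℝ} (hφ : Real.sin φ ≠ 0) (n : ℕ) :
    mpDeriv lam φ (n + 2) = C (1 / ((n : ℝ) + 2)) *
      ((C (2 * Real.cos φ) * X - C (2 * ((n : ℝ) + 1 + lam) * Real.sin φ)) * mpPoly lam φ (n + 1)
      + (C (2 * Real.sin φ) * X + C (2 * ((n : ℝ) + 1 + lam) * Real.cos φ)) * mpDeriv lam φ (n + 1)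
      - C ((n : ℝ) + 2 * lam) * mpDeriv lam φ n) := by
  refine Polynomial.funext fun x => ?_
  have hn2 : (n + 2 : ℝ) ≠ 0 := by positivity
  have hR := congrArg (fun p : ℝ[X] => p.eval x) (mpPoly_succ lam φ n)
  have hR2 := congrArg (fun p : ℝ[X] => p.eval x) (mpPoly_add_two lam φ n)
  simp only [eval_sub, eval_add, eval_mul, eval_C, eval_X] at hR hR2
  simp only [mpDeriv, mpPrev_succ, eval_sub, eval_add, eval_mul, eval_C, eval_X]
  push_cast
  generalize eval x (mpPoly lam φ (n + 2)) = p2 at *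
  generalize eval x (mpPoly lam φ (n + 1)) = p1 at *
  generalize eval x (mpPoly lam φ n) = p0 at *
  generalize eval x (mpPrev lam φ n) = q at *
  have hs := Real.sin_sq_add_cos_sq φ
  generalize Real.sin φ = s at *
  generalize Real.cos φ = c at *
  field_simp
  linear_combination (n + 2) * c * hR2 - (n + 2 * lam) * hR + 2 * (n + 1 + lam) * p1 * hs

lemma map_C_mul (L : ℝ[X] →ₗ[ℝ] ℝ) (a : ℝ) (p : ℝ[X]) : L (C a * p) = a * L p := by
  rw [← smul_eq_C_mul, map_smul, smul_eq_mul]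

/-- Leibniz rule for a differentiable family of functionals applied to `X ^ k * P_n(·; φ)`. -/
lemma hasDerivAt_map_mpPoly (lam : ℝ) {φ : ℝ} (hφ : Real.sin φ ≠ 0) {L : ℝ → ℝ[X] →ₗ[ℝ] ℝ}
    {L' : ℝ[X] →ₗ[ℝ] ℝ} (hL : ∀ k, HasDerivAt (fun t => L t (X ^ k)) (L' (X ^ k)) φ) (n k : ℕ) :
    HasDerivAt (fun t => L t (X ^ k * mpPoly lam t n))
      (L' (X ^ k * mpPoly lam φ n) + L φ (X ^ k * mpDeriv lam φ n)) φ := by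
  -- The factor X in the recurrence shifts k to k + 1, so k must vary.
  induction n using Nat.strong_induction_on generalizing k with
  | _ n ih =>
    match n, ih with
    | 0, _ => simpa [mpPoly, mpDeriv_zero] using hL k
    | 1, _ =>
      have h := (((Real.hasDerivAt_sin φ).const_mul 2).fun_mul (hL (k + 1))).fun_add
        (((Real.hasDerivAt_cos φ).const_mul (2 * lam)).fun_mul (hL k))
      have e : ∀ (M : ℝ[X] →ₗ[ℝ] ℝ) (a b : ℝ), M (X ^ k * (C a * X + C b))
          = a * M (X ^ (k + 1)) + b * M (X ^ k) := by
        intro M a b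
        rw [← map_C_mul, ← map_C_mul, ← map_add]
        congr 1; ring
      rw [mpDeriv_one lam hφ, sub_eq_add_neg, ← C_neg]
      simp only [mpPoly, e]
      convert! h using 1
      ring
    | n + 2, ih =>
      have i1 := ih (n + 1) (by omega)
      have i0 := ih n (by omega) k
      have h := ((((Real.hasDerivAt_sin φ).const_mul 2).fun_mul (i1 (k + 1))).fun_add
        (((Real.hasDerivAt_cos φ).const_mul (2 * ((n : ℝ) + 1 + lam))).fun_mul (i1 k))).fun_sub
        (i0.const_mul ((n : ℝ) + 2 * lam)) |>.const_mul (1 / ((n : ℝ) + 2))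
      have e : ∀ (M : ℝ[X] →ₗ[ℝ] ℝ) (d a b c : ℝ) (p q : ℝ[X]),
          M (X ^ k * (C d * ((C a * X + C b) * p - C c * q)))
          = d * (a * M (X ^ (k + 1) * p) + b * M (X ^ k * p) - c * M (X ^ k * q)) := by
        intro M d a b c p q
        rw [← map_C_mul, ← map_C_mul, ← map_C_mul, ← map_add, ← map_sub, ← map_C_mul]
        congr 1; ring
      have e' : ∀ (M : ℝ[X] →ₗ[ℝ] ℝ) (d a b a' b' c : ℝ) (p p' q : ℝ[X]),
          M (X ^ k * (C d * ((C a' * X - C b') * p + (C a * X + C b) * p' - C c * q)))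
          = d * (a' * M (X ^ (k + 1) * p) - b' * M (X ^ k * p)
            + (a * M (X ^ (k + 1) * p') + b * M (X ^ k * p')) - c * M (X ^ k * q)) := by
        intro M d a b a' b' c p p' q
        simp only [← map_C_mul, ← map_add, ← map_sub]
        congr 1; ring
      rw [mpDeriv_add_two lam hφ]
      simp only [mpPoly, e, e']
      convert! h using 1
      ring

lemma hasDerivAt_mpPoly_eval (lam x : ℝ) {φ : ℝ} (hφ : Real.sin φ ≠ 0) (n : ℕ) :
    HasDerivAt (fun t => (mpPoly lam t n).eval x) ((mpDeriv lam φ n).eval x) φ := by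
  -- Evaluation at x is a family constant in φ, hence with derivative 0.
  simpa using hasDerivAt_map_mpPoly lam hφ (L := fun _ => leval x) (L' := 0)
    (fun k => hasDerivAt_const φ _) n 0

/-- The raising relation for `∂/∂φ + 2x`. -/
lemma sin_mul_two_X_mul_add_mpDeriv (lam : ℝ) {φ : ℝ} (hφ : Real.sin φ ≠ 0) (n : ℕ) :
    C (Real.sin φ) * (C 2 * X * mpPoly lam φ n + mpDeriv lam φ n)
      = C ((n : ℝ) + 1) * mpPoly lam φ (n + 1)
        - C (((n : ℝ) + 2 * lam) * Real.cos φ) * mpPoly lam φ n := by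
  have h : C (Real.sin φ) * mpDeriv lam φ n = C (n * Real.cos φ) * mpPoly lam φ n
      - C ((n : ℝ) + 2 * lam - 1) * mpPrev lam φ n := by
    rw [mpDeriv, ← mul_assoc, ← C_mul, mul_one_div_cancel hφ, C_1, one_mul]
  rw [mul_add, h, mpPoly_succ]
  simp only [C_mul, C_add, C_sub, C_ofNat]
  ring

/-! ### Orthogonality and norms from the recurrence -/

/-- Two instances of the three-term recurrence combined. -/
lemma mpPoly_succ_mul (lam φ : ℝ) (m n : ℕ) :
    C ((m : ℝ) + 1) * (mpPoly lam φ (m + 1) * mpPoly lam φ n)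
      = C ((n : ℝ) + 1) * (mpPoly lam φ m * mpPoly lam φ (n + 1))
        + C ((n : ℝ) + 2 * lam - 1) * (mpPoly lam φ m * mpPrev lam φ n)
        + C (2 * ((m : ℝ) - n) * Real.cos φ) * (mpPoly lam φ m * mpPoly lam φ n)
        - C ((m : ℝ) + 2 * lam - 1) * (mpPrev lam φ m * mpPoly lam φ n) := by
  have h1 := mpPoly_succ lam φ m
  have h2 := mpPoly_succ lam φ n
  simp only [C_mul, C_add, C_sub] at h1 h2 ⊢
  linear_combination mpPoly lam φ n * h1 - mpPoly lam φ m * h2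

/-- If a functional kills `P_n` for `n ≥ 1`, then the `P_n` are orthogonal for it. -/
lemma map_mpPoly_mul_eq_zero {lam φ : ℝ} {L : ℝ[X] →ₗ[ℝ] ℝ}
    (hL : ∀ n, L (mpPoly lam φ (n + 1)) = 0) {m n : ℕ} (hmn : m < n) :
    L (mpPoly lam φ m * mpPoly lam φ n) = 0 := by
  induction m using Nat.strong_induction_on generalizing n with
  | _ m ih =>
    match m, ih with
    | 0, _ =>
      obtain ⟨n, rfl⟩ := Nat.exists_eq_succ_of_ne_zero hmn.ne'
      simpa [mpPoly] using hL n
    | m + 1, ih =>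
      obtain ⟨n, rfl⟩ := Nat.exists_eq_succ_of_ne_zero (Nat.ne_zero_of_lt hmn)
      -- Every product on the right has first index at most m, still below the second.
      have h := congrArg L (mpPoly_succ_mul lam φ m (n + 1))
      have h0 : L (mpPrev lam φ m * mpPoly lam φ (n + 1)) = 0 := by
        cases m with
        | zero => simp [mpPrev]
        | succ m => exact ih m (by omega) (by omega)
      simp only [map_sub L, map_add L, map_C_mul, mpPrev_succ, h0, ih m (by omega) (n := n + 2)
        (by omega), ih m (by omega) (n := n) (by omega), ih m (by omega) (n := n + 1) (by omega),
        mul_zero, add_zero, sub_zero] at h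
      have : (m : ℝ) + 1 ≠ 0 := by positivity
      simpa [this] using h

/-- The combined recurrence at indices n and n + 1: orthogonality removes all but the two squares.
-/
lemma map_mpPoly_succ_sq {lam φ : ℝ} {L : ℝ[X] →ₗ[ℝ] ℝ}
    (hL : ∀ n, L (mpPoly lam φ (n + 1)) = 0) (n : ℕ) :
    ((n : ℝ) + 1) * L (mpPoly lam φ (n + 1) ^ 2) = (n + 2 * lam) * L (mpPoly lam φ n ^ 2) := by
  have h := congrArg L (mpPoly_succ_mul lam φ n (n + 1))
  have h0 : L (mpPrev lam φ n * mpPoly lam φ (n + 1)) = 0 := by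
    cases n with
    | zero => simp [mpPrev]
    | succ n => exact map_mpPoly_mul_eq_zero hL (by omega)
  simp only [map_sub L, map_add L, map_C_mul, mpPrev_succ, h0,
    map_mpPoly_mul_eq_zero hL (show n < n + 2 by omega),
    map_mpPoly_mul_eq_zero hL (show n < n + 1 by omega), ← sq] at h
  rw [h]
  push_cast
  ring

lemma mul_map_mpPrev_sq {lam φ : ℝ} {L : ℝ[X] →ₗ[ℝ] ℝ}
    (hL : ∀ n, L (mpPoly lam φ (n + 1)) = 0) (n : ℕ) :
    ((n : ℝ) + 2 * lam - 1) * L (mpPrev lam φ n ^ 2) = n * L (mpPoly lam φ n ^ 2) := by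
  cases n with
  | zero => simp [mpPrev]
  | succ n =>
    rw [mpPrev_succ]
    push_cast
    rw [map_mpPoly_succ_sq hL n]
    ring

/-- The point is that c depends on neither φ nor L, so the φ-dependence of h_n is that of the total
mass. -/
lemma exists_map_mpPoly_sq {lam : ℝ} (hlam : 0 < lam) (n : ℕ) :
    ∃ c > 0, ∀ {φ : ℝ} {L : ℝ[X] →ₗ[ℝ] ℝ}, (∀ n, L (mpPoly lam φ (n + 1)) = 0) →
      L (mpPoly lam φ n ^ 2) = c * L 1 := by
  induction n with
  | zero => exact ⟨1, one_pos, fun _ => by simp [mpPoly]⟩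
  | succ n ih =>
    obtain ⟨c, hc, h⟩ := ih
    refine ⟨(n + 2 * lam) / (n + 1) * c, by positivity, fun {φ L} hL => ?_⟩
    have h1 := map_mpPoly_succ_sq hL n
    rw [h hL] at h1
    field_simp
    linear_combination h1

/-- The numerator of the Fisher information. -/
lemma map_sq_sub_sq {lam φ : ℝ} {L : ℝ[X] →ₗ[ℝ] ℝ}
    (hL : ∀ n, L (mpPoly lam φ (n + 1)) = 0) (n : ℕ) :
    L ((C ((n : ℝ) + 1) * mpPoly lam φ (n + 1) - C ((n : ℝ) + 2 * lam - 1) * mpPrev lam φ n) ^ 2)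
      = 2 * ((n : ℝ) ^ 2 + (2 * n + 1) * lam) * L (mpPoly lam φ n ^ 2) := by
  have h0 : L (mpPrev lam φ n * mpPoly lam φ (n + 1)) = 0 := by
    cases n with
    | zero => simp [mpPrev]
    | succ n => exact map_mpPoly_mul_eq_zero hL (by omega)
  have e : ∀ (a b : ℝ) (p q : ℝ[X]), L ((C a * p - C b * q) ^ 2)
      = a * (a * L (p ^ 2)) - 2 * a * b * L (q * p) + b * (b * L (q ^ 2)) := by
    intro a b p q
    simp only [← map_C_mul, ← map_add, ← map_sub]
    congr 1
    simp only [C_mul, C_ofNat]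
    ring
  rw [e, h0, map_mpPoly_succ_sq hL, mul_map_mpPrev_sq hL]
  ring

/-! ### The moment functional and its φ-derivative -/

/-- The density `|Γ(lam + ix)|² / (2π)`. -/
noncomputable def gammaDensity (lam x : ℝ) : NNReal :=
  Real.toNNReal (‖Complex.Gamma (lam + Complex.I * x)‖ ^ 2 / (2 * Real.pi))

lemma coe_gammaDensity (lam x : ℝ) : (gammaDensity lam x : ℝ)
    = ‖Complex.Gamma (lam + Complex.I * x)‖ ^ 2 / (2 * Real.pi) :=
  Real.coe_toNNReal _ (by positivity)

lemma measurable_gammaDensity {lam : ℝ} (hlam : 0 < lam) : Measurable (gammaDensity lam) :=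
  ((((continuous_norm_Gamma_vertical hlam).pow 2).div_const _).measurable).real_toNNReal

lemma gammaDensity_smul (lam φ x y : ℝ) :
    gammaDensity lam x • (y * Real.exp ((2 * φ - Real.pi) * x))
      = y * meixnerPollaczekWeight lam φ x := by
  rw [NNReal.smul_def, coe_gammaDensity, meixnerPollaczekWeight, smul_eq_mul]
  ring

/-- The measure with density `|Γ(lam + ix)|² / (2π)`. -/
noncomputable def gammaMeasureVertical (lam : ℝ) : Measure ℝ :=
  volume.withDensity fun x => gammaDensity lam x

/-- The weight is a fixed measure tilted by e^(tx) with t = 2φ - π in (-π, π). Interior points of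
the set of integrable tilts have all moments, and these may be differentiated under the integral. -/
lemma mem_interior_integrableExpSet {lam φ : ℝ} (hlam : 0 < lam) (hφ : φ ∈ Ioo 0 Real.pi) :
    2 * φ - Real.pi ∈ interior (integrableExpSet id (gammaMeasureVertical lam)) := by
  refine mem_interior.2 ⟨Ioo (-Real.pi) Real.pi, fun t ht => ?_, isOpen_Ioo, ?_⟩
  · rw [integrableExpSet, mem_ofPred_eq, gammaMeasureVertical,
      integrable_withDensity_iff_integrable_smul (measurable_gammaDensity hlam)]
    refine (integrable_meixnerPollaczekWeight hlam (φ := (t + Real.pi) / 2) (by linarith [ht.1])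
      (by linarith [ht.2])).congr (Eventually.of_forall fun x => ?_)
    have := gammaDensity_smul lam ((t + Real.pi) / 2) x 1
    rw [one_mul, one_mul] at this
    simp only [id]
    rw [← this]
    ring_nf
  · constructor <;> linarith [hφ.1, hφ.2]

/-- The moments of the Meixner–Pollaczek weight. -/
noncomputable def mpMoment (lam φ : ℝ) (k : ℕ) : ℝ := ∫ x, x ^ k * meixnerPollaczekWeight lam φ x

lemma mpMoment_eq {lam : ℝ} (hlam : 0 < lam) (φ : ℝ) (k : ℕ) : mpMoment lam φ k
    = ∫ x, id x ^ k * Real.exp ((2 * φ - Real.pi) * id x) ∂(gammaMeasureVertical lam) := by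
  rw [gammaMeasureVertical, integral_withDensity_eq_integral_smul (measurable_gammaDensity hlam)]
  simp only [id, gammaDensity_smul, mpMoment]

lemma integrable_pow_mul_weight {lam φ : ℝ} (hlam : 0 < lam) (hφ : φ ∈ Ioo 0 Real.pi) (k : ℕ) :
    Integrable fun x => x ^ k * meixnerPollaczekWeight lam φ x := by
  have h := integrable_pow_mul_exp_of_mem_interior_integrableExpSet
    (mem_interior_integrableExpSet hlam hφ) k
  rw [gammaMeasureVertical,
    integrable_withDensity_iff_integrable_smul (measurable_gammaDensity hlam)] at h
  simpa only [id, gammaDensity_smul] using h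

lemma hasDerivAt_mpMoment {lam φ : ℝ} (hlam : 0 < lam) (hφ : φ ∈ Ioo 0 Real.pi) (k : ℕ) :
    HasDerivAt (fun t => mpMoment lam t k) (2 * mpMoment lam φ (k + 1)) φ := by
  have h := hasDerivAt_integral_pow_mul_exp_real (mem_interior_integrableExpSet hlam hφ) k
  have h2 : HasDerivAt (fun t : ℝ => 2 * t - Real.pi) 2 φ := by
    simpa using ((hasDerivAt_id φ).const_mul 2).sub_const Real.pi
  have h3 := HasDerivAt.comp φ h h2
  rw [← mpMoment_eq hlam, mul_comm] at h3
  refine h3.congr_of_eventuallyEq (Eventually.of_forall fun t => ?_)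
  exact mpMoment_eq hlam t k

/-- The moment functional `p ↦ ∫ p(x) ρ(x; φ) dx`. -/
noncomputable def mpFunctional (lam φ : ℝ) : ℝ[X] →ₗ[ℝ] ℝ :=
  Polynomial.lsum fun k => mpMoment lam φ k • LinearMap.id

lemma mpFunctional_X_pow (lam φ : ℝ) (k : ℕ) : mpFunctional lam φ (X ^ k) = mpMoment lam φ k := by
  rw [mpFunctional, Polynomial.lsum_apply, X_pow_eq_monomial, sum_monomial_index] <;> simp

lemma integrable_eval_mul_weight {lam φ : ℝ} (hlam : 0 < lam) (hφ : φ ∈ Ioo 0 Real.pi) (p : ℝ[X]) :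
    Integrable fun x => p.eval x * meixnerPollaczekWeight lam φ x := by
  simp_rw [eval_eq_sum, Polynomial.sum, Finset.sum_mul, mul_assoc]
  exact integrable_finsetSum _ fun k _ => (integrable_pow_mul_weight hlam hφ k).const_mul _

lemma integral_eval_mul_weight {lam φ : ℝ} (hlam : 0 < lam) (hφ : φ ∈ Ioo 0 Real.pi) (p : ℝ[X]) :
    ∫ x, p.eval x * meixnerPollaczekWeight lam φ x = mpFunctional lam φ p := by
  simp_rw [eval_eq_sum, Polynomial.sum, Finset.sum_mul, mul_assoc]
  rw [integral_finsetSum _ fun k _ => (integrable_pow_mul_weight hlam hφ k).const_mul _]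
  simp_rw [integral_const_mul]
  rw [mpFunctional, Polynomial.lsum_apply, Polynomial.sum]
  refine Finset.sum_congr rfl fun k _ => ?_
  rw [LinearMap.smul_apply, LinearMap.id_apply, smul_eq_mul, mul_comm, mpMoment]

lemma hasDerivAt_mpFunctional_X_pow {lam φ : ℝ} (hlam : 0 < lam) (hφ : φ ∈ Ioo 0 Real.pi) (k : ℕ) :
    HasDerivAt (fun t => mpFunctional lam t (X ^ k))
      ((mpFunctional lam φ ∘ₗ LinearMap.mulLeft ℝ (C 2 * X)) (X ^ k)) φ := by
  rw [LinearMap.comp_apply, LinearMap.mulLeft_apply, mul_assoc, map_C_mul, ← pow_succ']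
  simp_rw [mpFunctional_X_pow]
  exact hasDerivAt_mpMoment hlam hφ k

/-! ### Vanishing of L_φ(P_n) for n ≥ 1 and the Fisher information -/

lemma sin_ne_zero_of_mem_Ioo {φ : ℝ} (hφ : φ ∈ Ioo 0 Real.pi) : Real.sin φ ≠ 0 :=
  (Real.sin_pos_of_mem_Ioo hφ).ne'

lemma mpMoment_zero {lam φ : ℝ} (hlam : 0 < lam) (hφ : φ ∈ Ioo 0 Real.pi) :
    mpMoment lam φ 0 = (1 / (2 * Real.sin φ)) ^ (2 * lam) * Real.Gamma (2 * lam) := by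
  simp only [mpMoment, pow_zero, one_mul]
  exact integral_meixnerPollaczekWeight hlam hφ.1 hφ.2

lemma mpMoment_zero_pos {lam φ : ℝ} (hlam : 0 < lam) (hφ : φ ∈ Ioo 0 Real.pi) :
    0 < mpMoment lam φ 0 := by
  rw [mpMoment_zero hlam hφ]
  have h1 := Real.Gamma_pos_of_pos (by positivity : 0 < 2 * lam)
  have h2 := Real.sin_pos_of_mem_Ioo hφ
  positivity

lemma hasDerivAt_mpMoment_zero {lam φ : ℝ} (hlam : 0 < lam) (hφ : φ ∈ Ioo 0 Real.pi) :
    HasDerivAt (fun t => mpMoment lam t 0)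
      (-(2 * lam * Real.cos φ / Real.sin φ) * mpMoment lam φ 0) φ := by
  have hs := Real.sin_pos_of_mem_Ioo hφ
  have h1 : HasDerivAt (fun t => (2 * Real.sin t) ^ (-(2 * lam)) * Real.Gamma (2 * lam))
      (2 * Real.cos φ * -(2 * lam) * (2 * Real.sin φ) ^ (-(2 * lam) - 1)
        * Real.Gamma (2 * lam)) φ :=
    (((Real.hasDerivAt_sin φ).const_mul 2).rpow_const (Or.inl (by positivity))).mul_const _
  have e : ∀ t ∈ Ioo 0 Real.pi, mpMoment lam t 0
      = (2 * Real.sin t) ^ (-(2 * lam)) * Real.Gamma (2 * lam) := by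
    intro t ht
    have := Real.sin_pos_of_mem_Ioo ht
    rw [mpMoment_zero hlam ht, one_div, Real.inv_rpow (by positivity),
      Real.rpow_neg (by positivity)]
  refine HasDerivAt.congr_of_eventuallyEq ?_
    (eventually_of_mem (isOpen_Ioo.mem_nhds hφ) e)
  rw [e φ hφ]
  convert! h1 using 1
  rw [Real.rpow_sub_one (by positivity)]
  field_simp

lemma mpFunctional_mpPoly_succ {lam φ : ℝ} (hlam : 0 < lam) (hφ : φ ∈ Ioo 0 Real.pi) (n : ℕ) :
    mpFunctional lam φ (mpPoly lam φ (n + 1)) = 0 := by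
  -- Differentiating the induction hypothesis requires it on a neighbourhood of φ.
  induction n generalizing φ with
  | zero =>
    -- Two values for the derivative of the total mass: twice the first moment, and -2λ cot φ times
    -- the mass. Their equality is L_φ(P_1) = 0.
    have h := (hasDerivAt_mpMoment hlam hφ 0).unique (hasDerivAt_mpMoment_zero hlam hφ)
    have hs := sin_ne_zero_of_mem_Ioo hφ
    rw [zero_add, mpPoly, map_add, map_C_mul, ← mul_one (C _), map_C_mul, ← pow_zero X, ← pow_one X]
    rw [← pow_mul, mpFunctional_X_pow, mpFunctional_X_pow]
    rw [zero_add] at h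
    field_simp at h
    simp only [mul_zero]
    linear_combination 2 * h
  | succ n ih =>
    have hs := sin_ne_zero_of_mem_Ioo hφ
    have h := hasDerivAt_map_mpPoly lam hs (hasDerivAt_mpFunctional_X_pow hlam hφ) (n + 1) 0
    simp only [pow_zero, one_mul, LinearMap.comp_apply, LinearMap.mulLeft_apply] at h
    have h0 : HasDerivAt (fun t => mpFunctional lam t (mpPoly lam t (n + 1))) 0 φ :=
      (hasDerivAt_const φ (0 : ℝ)).congr_of_eventuallyEq
        (eventually_of_mem (isOpen_Ioo.mem_nhds hφ) fun t ht => ih ht)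
    have h1 := h.unique h0
    rw [← map_add] at h1
    -- The raising relation rewrites the vanishing derivative as a multiple of L_φ(P_{n+2}), plus a
    -- term killed by the induction hypothesis.
    have h2 := congrArg (mpFunctional lam φ) (sin_mul_two_X_mul_add_mpDeriv lam hs (n + 1))
    rw [map_C_mul, h1, map_sub, map_C_mul, map_C_mul, ih hφ, mul_zero, mul_zero, sub_zero,
      eq_comm, mul_eq_zero] at h2
    refine h2.resolve_left (by positivity)

lemma integrable_mp_sq {lam φ : ℝ} (hlam : 0 < lam) (hφ : φ ∈ Ioo 0 Real.pi) (n : ℕ) :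
    Integrable fun x => meixnerPollaczek lam n φ x ^ 2 * meixnerPollaczekWeight lam φ x := by
  simp_rw [meixnerPollaczek_eq hlam, ← eval_pow]
  exact integrable_eval_mul_weight hlam hφ _

lemma normSq_eq {lam φ : ℝ} (hlam : 0 < lam) (hφ : φ ∈ Ioo 0 Real.pi) (n : ℕ) :
    meixnerPollaczekNormSq lam n φ = mpFunctional lam φ (mpPoly lam φ n ^ 2) := by
  simp_rw [meixnerPollaczekNormSq, meixnerPollaczek_eq hlam, ← eval_pow]
  exact integral_eval_mul_weight hlam hφ _

lemma exists_normSq_eq {lam : ℝ} (hlam : 0 < lam) (n : ℕ) :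
    ∃ c > 0, ∀ φ ∈ Ioo 0 Real.pi, meixnerPollaczekNormSq lam n φ = c * mpMoment lam φ 0 := by
  obtain ⟨c, hc, h⟩ := exists_map_mpPoly_sq hlam n
  refine ⟨c, hc, fun φ hφ => ?_⟩
  rw [normSq_eq hlam hφ, h fun n => mpFunctional_mpPoly_succ hlam hφ n, ← mpFunctional_X_pow,
    pow_zero]

lemma normSq_pos {lam φ : ℝ} (hlam : 0 < lam) (hφ : φ ∈ Ioo 0 Real.pi) (n : ℕ) :
    0 < meixnerPollaczekNormSq lam n φ := by
  obtain ⟨c, hc, h⟩ := exists_normSq_eq hlam n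
  rw [h φ hφ]
  exact mul_pos hc (mpMoment_zero_pos hlam hφ)

lemma hasDerivAt_normSq {lam φ : ℝ} (hlam : 0 < lam) (hφ : φ ∈ Ioo 0 Real.pi) (n : ℕ) :
    HasDerivAt (meixnerPollaczekNormSq lam n)
      (-(2 * lam * Real.cos φ / Real.sin φ) * meixnerPollaczekNormSq lam n φ) φ := by
  obtain ⟨c, hc, h⟩ := exists_normSq_eq hlam n
  have h1 := (hasDerivAt_mpMoment_zero hlam hφ).const_mul c
  rw [h φ hφ, mul_left_comm]
  exact h1.congr_of_eventuallyEq (eventually_of_mem (isOpen_Ioo.mem_nhds hφ) h)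

lemma hasDerivAt_weight (lam φ x : ℝ) : HasDerivAt (fun t => meixnerPollaczekWeight lam t x)
    (2 * x * meixnerPollaczekWeight lam φ x) φ := by
  unfold meixnerPollaczekWeight
  have h : HasDerivAt (fun t : ℝ => (2 * t - Real.pi) * x) (2 * x) φ := by
    simpa using (((hasDerivAt_id φ).const_mul 2).sub_const Real.pi).mul_const x
  convert! (h.exp.mul_const (‖Complex.Gamma (lam + Complex.I * x)‖ ^ 2)).div_const
    (2 * Real.pi) using 1
  ring

/-- The score is 2 (∂P_n/∂φ)/P_n + 2x + 2λ cot φ. Multiplied by P_n sin φ, the recurrence eliminates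
xP_n and only the two neighbours remain. -/
lemma hasDerivAt_density {lam φ : ℝ} (hlam : 0 < lam) (hφ : φ ∈ Ioo 0 Real.pi) (n : ℕ) (x : ℝ) :
    HasDerivAt (fun t => meixnerPollaczekDensity lam n t x)
      ((mpPoly lam φ n).eval x * ((C ((n : ℝ) + 1) * mpPoly lam φ (n + 1)
        - C ((n : ℝ) + 2 * lam - 1) * mpPrev lam φ n).eval x) * meixnerPollaczekWeight lam φ x
        / (meixnerPollaczekNormSq lam n φ * Real.sin φ)) φ := by
  have hs := sin_ne_zero_of_mem_Ioo hφ
  have hn := (normSq_pos hlam hφ n).ne'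
  unfold meixnerPollaczekDensity
  simp_rw [meixnerPollaczek_eq hlam]
  convert! (((hasDerivAt_mpPoly_eval lam x hs n).fun_pow 2).fun_mul
    (hasDerivAt_weight lam φ x)).fun_div (hasDerivAt_normSq hlam hφ n) hn using 1
  have hR := congrArg (fun p : ℝ[X] => p.eval x) (mpPoly_succ lam φ n)
  simp only [mpDeriv, eval_sub, eval_add, eval_mul, eval_C, eval_X] at hR ⊢
  push_cast
  field_simp
  linear_combination (mpPoly lam φ n).eval x * meixnerPollaczekWeight lam φ x * hR

lemma fisherIntegrand_density_ae_eq {lam φ : ℝ} (hlam : 0 < lam) (hφ : φ ∈ Ioo 0 Real.pi) (n : ℕ) :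
    fisherIntegrand (meixnerPollaczekDensity lam n) φ =ᵐ[volume] fun x =>
      (((C ((n : ℝ) + 1) * mpPoly lam φ (n + 1)
        - C ((n : ℝ) + 2 * lam - 1) * mpPrev lam φ n) ^ 2).eval x * meixnerPollaczekWeight lam φ x)
        / (meixnerPollaczekNormSq lam n φ * Real.sin φ ^ 2) := by
  have hn := (normSq_pos hlam hφ n).ne'
  have hs := sin_ne_zero_of_mem_Ioo hφ
  have hp : mpPoly lam φ n ≠ 0 := by
    intro h
    rw [normSq_eq hlam hφ, h] at hn
    simp at hn
  have hfin : {x | (mpPoly lam φ n).eval x = 0}.Finite := by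
    refine (mpPoly lam φ n).roots.toFinset.finite_toSet.subset fun x hx => ?_
    simpa [hp] using hx
  -- Off the finite, hence null, zero set of P_n the factor P_n² cancels.
  filter_upwards [hfin.countable.ae_notMem volume] with x hx
  have hx' : (mpPoly lam φ n).eval x ≠ 0 := hx
  have hw : meixnerPollaczekWeight lam φ x ≠ 0 := by
    have : Complex.Gamma (lam + Complex.I * x) ≠ 0 :=
      Complex.Gamma_ne_zero_of_re_pos (by simpa)
    unfold meixnerPollaczekWeight
    positivity
  rw [fisherIntegrand, (hasDerivAt_density hlam hφ n x).deriv, meixnerPollaczekDensity,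
    meixnerPollaczek_eq hlam, eval_pow]
  field_simp

theorem mainTheorem2 (lam : ℝ) (hlam : 0 < lam) (n : ℕ) (φ : ℝ) (hφ0 : 0 < φ)
    (hφπ : φ < Real.pi) :
    (∀ x : ℝ, (meixnerPollaczek lam n φ x : ℂ) = meixnerPollaczekComplex lam n φ x) ∧
    MeasureTheory.Integrable
      (fun x : ℝ => meixnerPollaczek lam n φ x ^ 2 * meixnerPollaczekWeight lam φ x) ∧
    0 < meixnerPollaczekNormSq lam n φ ∧
    (∀ x : ℝ, DifferentiableAt ℝ (fun t : ℝ => meixnerPollaczekDensity lam n t x) φ) ∧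
    MeasureTheory.Integrable (fisherIntegrand (meixnerPollaczekDensity lam n) φ) ∧
    fisherInformation (meixnerPollaczekDensity lam n) φ
      = 2 * ((n : ℝ) ^ 2 + (2 * (n : ℝ) + 1) * lam) / Real.sin φ ^ 2 := by
  have hφ : φ ∈ Ioo 0 Real.pi := ⟨hφ0, hφπ⟩
  have hn := (normSq_pos hlam hφ n).ne'
  have hs := sin_ne_zero_of_mem_Ioo hφ
  refine ⟨fun x => ?_, integrable_mp_sq hlam hφ n, normSq_pos hlam hφ n,
    fun x => (hasDerivAt_density hlam hφ n x).differentiableAt, ?_, ?_⟩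
  · rw [meixnerPollaczek_eq hlam, meixnerPollaczekComplex_eq hlam]
  · exact ((integrable_eval_mul_weight hlam hφ _).div_const _).congr
      (fisherIntegrand_density_ae_eq hlam hφ n).symm
  · rw [fisherInformation, integral_congr_ae (fisherIntegrand_density_ae_eq hlam hφ n),
      integral_div, integral_eval_mul_weight hlam hφ,
      map_sq_sub_sq fun n => mpFunctional_mpPoly_succ hlam hφ n, ← normSq_eq hlam hφ]
    field_simp
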